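/- Permutations are finite bijections $\pi$ of $\{1,\dots,n\}$, $n\ge 0$ (the empty permutation being allowed). A permutation $\pi$ contains $\sigma$ if $\pi$ has a subsequence order isomorphic to $\sigma$, and a permutation class is a set of permutations closed downward under containment. The direct sum of $\pi$ of length $m$ and $\sigma$ of length $n$ is the permutation $\pi\oplus\sigma$ of length $m+n$ with $(\pi\oplus\sigma)(i)=\pi(i)$ for $1\le i\le m$ and $(\pi\oplus\sigma)(i)=\sigma(i-m)+m$ for $m+1\le i\le m+n$. For classes $\mathcal{C},\mathcal{D}$ let $\mathcal{C}\oplus\mathcal{D}=\{\pi\oplus\sigma:\pi\in\mathcal{C},\ \sigma\in\mathcal{D}\}$; the class $\mathcal{C}$ is sum closed if $\mathcal{C}\oplus\mathcal{C}\subseteq\mathcal{C}$, and the sum completion $\bigoplus\mathcal{C}$ is the smallest sum closed class containing $\mathcal{C}$. The generating function of $\mathcal{C}$ is $\sum_{n\ge1}|\mathcal{C}_n|x^n$, where $\mathcal{C}_n$ is the set of permutations of length $n$ in $\mathcal{C}$. A permutation class is strongly rational if it and all of its subclasses have rational generating functions, i.e. generating functions that are quotients of polynomials in $\mathbb{Q}[x]$.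 If $\mathcal{U}$ is a strongly rational class, then its sum completion $\bigoplus\mathcal{U}$ is also strongly rational. If $\mathcal{D}$ and $\mathcal{E}$ are strongly rational classes, then $\mathcal{D}\oplus\mathcal{E}$ is also strongly rational (in particular, it is a permutation class). -/

import Mathlib

open scoped Polynomial PowerSeries

namespace PermPattern

/-- A (finite) permutation: a length `n` together with a bijection of `{0, …, n - 1}`.
The empty permutation (`n = 0`) is included. -/
abbrev Permutation : Type := Σ n : ℕ, Equiv.Perm (Fin n)

/-- `Contains π σ` (written `σ ≤ π` in the literature): `π` has a subsequence, at the positions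
given by the increasing map `f`, that is order isomorphic to `σ`. -/
def Contains (π σ : Permutation) : Prop :=
  ∃ f : Fin σ.1 ↪o Fin π.1, ∀ i j : Fin σ.1, π.2 (f i) < π.2 (f j) ↔ σ.2 i < σ.2 j

/-- A permutation class: a set of permutations closed downward under containment. -/
def IsPermClass (C : Set Permutation) : Prop :=
  ∀ π ∈ C, ∀ σ : Permutation, Contains π σ → σ ∈ C

/-- The direct sum of two permutations, of length the sum of the lengths. -/
def directSum (π σ : Permutation) : Permutation :=
  ⟨π.1 + σ.1, finSumFinEquiv.symm.trans ((Equiv.sumCongr π.2 σ.2).trans finSumFinEquiv)⟩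

/-- On the first `m` positions, where `m` is the length of `π`, `π ⊕ σ` is `π`. -/
theorem directSum_castAdd (π σ : Permutation) (i : Fin π.1) :
    (directSum π σ).2 (Fin.castAdd σ.1 i) = Fin.castAdd σ.1 (π.2 i) := by
  change finSumFinEquiv (Sum.map π.2 σ.2 (finSumFinEquiv.symm _)) = _
  simp

/-- On the remaining positions, `π ⊕ σ` is `σ` shifted up by the length of `π`. -/
theorem directSum_natAdd (π σ : Permutation) (i : Fin σ.1) :
    (directSum π σ).2 (Fin.natAdd π.1 i) = Fin.natAdd π.1 (σ.2 i) := by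
  change finSumFinEquiv (Sum.map π.2 σ.2 (finSumFinEquiv.symm _)) = _
  simp

/-- `C ⊕ D`: all permutations `π ⊕ σ` with `π ∈ C` and `σ ∈ D`. -/
def setSum (C D : Set Permutation) : Set Permutation :=
  {τ | ∃ π ∈ C, ∃ σ ∈ D, τ = directSum π σ}

/-- `C` is sum closed if `C ⊕ C ⊆ C`. -/
def SumClosed (C : Set Permutation) : Prop :=
  setSum C C ⊆ C

/-- The sum completion of `C`: the smallest sum closed class containing `C`, constructed as the
intersection of all of them (see `sumCompletion_isLeast`). -/
def sumCompletion (C : Set Permutation) : Set Permutation :=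
  ⋂₀ {S | IsPermClass S ∧ SumClosed S ∧ C ⊆ S}

/-- The sum completion is indeed the smallest sum closed class containing `C`. -/
theorem sumCompletion_isLeast (C : Set Permutation) :
    IsLeast {S | IsPermClass S ∧ SumClosed S ∧ C ⊆ S} (sumCompletion C) := by
  refine ⟨⟨?_, ?_, ?_⟩, fun S hS => Set.sInter_subset_of_mem hS⟩
  · intro π hπ σ h S hS
    exact hS.1 π (hπ S hS) σ h
  · rintro τ ⟨π, hπ, σ, hσ, rfl⟩ S hS
    exact hS.2.1 ⟨π, hπ S hS, σ, hσ S hS, rfl⟩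
  · exact Set.subset_sInter fun S hS => hS.2.2

/-- The number `|C_n|` of permutations of length `n` in `C`. -/
noncomputable def count (C : Set Permutation) (n : ℕ) : ℕ :=
  Set.ncard {π : Equiv.Perm (Fin n) | (⟨n, π⟩ : Permutation) ∈ C}

/-- The generating function `∑_{n ≥ 1} |C_n| x^n`; the empty permutation is not counted. -/
noncomputable def genFun (C : Set Permutation) : ℚ⟦X⟧ :=
  PowerSeries.mk fun n => if n = 0 then 0 else (count C n : ℚ)

/-- A power series is rational if it is a quotient of two polynomials. -/
def IsRationalSeries (f : ℚ⟦X⟧) : Prop :=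
  ∃ p q : ℚ[X], q ≠ 0 ∧ (q : ℚ⟦X⟧) * f = (p : ℚ⟦X⟧)

/-- `C` is a strongly rational class: it is a permutation class, and it and all of its subclasses
have rational generating functions. -/
def StronglyRational (C : Set Permutation) : Prop :=
  IsPermClass C ∧ ∀ D ⊆ C, IsPermClass D → IsRationalSeries (genFun D)

end PermPattern

namespace PermPattern

/-! A strongly rational class has no infinite antichain: otherwise it would have uncountably many
subclasses with distinct generating functions, while there are only countably many rational series
(`StronglyRational.partiallyWellOrderedOn`). Its sum completion is then partially well ordered by
Higman's lemma, so subclasses satisfy the descending chain condition and allow induction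
(`class_induction`).

For a class `C` and a permutation `α`, the fiber of `α` is the class of all `β` with `α ⊕ β ∈ C`.
Partial well order leaves only finitely many fibers, and splitting off the first sum indecomposable
summand gives `ogf C = 1 + ∑ V, ogf (indecFiber C V) * ogf V` (`ogf_eq_sum`). Inside a strongly
rational class this is solved inductively for the series of the indecomposables. Inside the sum
completion, whose indecomposables already lie in `U`, it is solved for `ogf C`. Finally `D ⊕ E` lies
in the sum completion of `D ∪ E`, which is strongly rational by inclusion-exclusion. -/

theorem Contains.refl (π : Permutation) : Contains π π :=
  ⟨RelEmbedding.refl _, fun _ _ => Iff.rfl⟩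

theorem Contains.trans {π σ τ : Permutation} (h₁ : Contains π σ) (h₂ : Contains σ τ) :
    Contains π τ := by
  obtain ⟨f, hf⟩ := h₁
  obtain ⟨g, hg⟩ := h₂
  exact ⟨g.trans f, fun i j => (hf _ _).trans (hg i j)⟩

theorem Contains.length_le {π σ : Permutation} (h : Contains π σ) : σ.1 ≤ π.1 := by
  obtain ⟨f, -⟩ := h
  simpa using Fintype.card_le_of_injective f f.injective

/-- The empty permutation. -/
def empty : Permutation := ⟨0, Equiv.refl _⟩

theorem eq_empty_of_length_eq_zero {π : Permutation} (h : π.1 = 0) : π = empty := by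
  obtain ⟨n, π⟩ := π
  obtain rfl : n = 0 := h
  exact congrArg _ (Subsingleton.elim _ _)

theorem contains_empty (π : Permutation) : Contains π empty :=
  ⟨⟨⟨fun i => i.elim0, fun i => i.elim0⟩, fun {i} => i.elim0⟩, fun i => i.elim0⟩

theorem IsPermClass.empty_mem {C : Set Permutation} (hC : IsPermClass C) {π : Permutation}
    (h : π ∈ C) : empty ∈ C :=
  hC π h _ (contains_empty π)

/-- The containment order, with the smaller permutation on the left. -/
def Embeds (σ π : Permutation) : Prop := Contains π σ

instance : IsPreorder Permutation Embeds where
  refl := Contains.refl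
  trans _ _ _ h₁ h₂ := Contains.trans h₂ h₁

/-! ### Direct sums and containment, computed on `ℕ`. -/

/-- A permutation as a function on `ℕ`, the identity beyond its length. -/
def toFun (π : Permutation) (i : ℕ) : ℕ :=
  if h : i < π.1 then π.2 ⟨i, h⟩ else i

theorem toFun_val (π : Permutation) (i : Fin π.1) : toFun π i = π.2 i := by
  simp [toFun]

theorem toFun_of_le {π : Permutation} {i : ℕ} (h : π.1 ≤ i) : toFun π i = i := by
  simp [toFun, h]

theorem toFun_lt {π : Permutation} {i : ℕ} (h : i < π.1) : toFun π i < π.1 := by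
  simp [toFun, h]

theorem ext_toFun {π σ : Permutation} (h : π.1 = σ.1) (h' : ∀ i, toFun π i = toFun σ i) :
    π = σ := by
  obtain ⟨n, π⟩ := π
  obtain ⟨m, σ⟩ := σ
  obtain rfl : n = m := h
  congr 1
  ext i
  have := h' i
  rwa [toFun_val ⟨n, π⟩ i, toFun_val ⟨n, σ⟩ i] at this

theorem toFun_directSum (π σ : Permutation) (i : ℕ) :
    toFun (directSum π σ) i = if i < π.1 then toFun π i else toFun σ (i - π.1) + π.1 := by
  split_ifs with h
  · have := toFun_val (directSum π σ) (Fin.castAdd σ.1 ⟨i, h⟩)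
    rw [directSum_castAdd] at this
    simpa [← toFun_val] using this
  · obtain ⟨k, rfl⟩ := Nat.exists_eq_add_of_le (not_lt.1 h)
    rcases lt_or_ge k σ.1 with hk | hk
    · have := toFun_val (directSum π σ) (Fin.natAdd π.1 ⟨k, hk⟩)
      rw [directSum_natAdd] at this
      simpa [← toFun_val, add_comm] using this
    · rw [toFun_of_le (show (directSum π σ).1 ≤ π.1 + k from Nat.add_le_add_left hk _),
        toFun_of_le (by omega)]
      omega

theorem directSum_length (π σ : Permutation) : (directSum π σ).1 = π.1 + σ.1 := rfl

theorem empty_directSum (π : Permutation) : directSum empty π = π := by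
  refine ext_toFun (by simp [directSum_length, empty]) fun i => ?_
  rw [toFun_directSum]
  simp [empty]

theorem directSum_empty (π : Permutation) : directSum π empty = π := by
  refine ext_toFun (by simp [directSum_length, empty]) fun i => ?_
  rw [toFun_directSum]
  split_ifs with h
  · rfl
  · rw [toFun_of_le (show empty.1 ≤ _ from Nat.zero_le _), toFun_of_le (not_lt.1 h)]
    omega

theorem directSum_assoc (π σ τ : Permutation) :
    directSum (directSum π σ) τ = directSum π (directSum σ τ) := by
  refine ext_toFun (by simp [directSum_length, add_assoc]) fun i => ?_
  simp only [toFun_directSum, directSum_length]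
  split_ifs <;> first | rfl | omega | (rw [Nat.sub_sub]; omega)

theorem toFun_injective (π : Permutation) : Function.Injective (toFun π) := by
  intro i j h
  rcases lt_or_ge i π.1 with hi | hi <;> rcases lt_or_ge j π.1 with hj | hj
  · rw [toFun_val π ⟨i, hi⟩, toFun_val π ⟨j, hj⟩] at h
    simpa using π.2.injective (Fin.ext h)
  · have := toFun_lt hi
    rw [h, toFun_of_le hj] at this
    omega
  · have := toFun_lt hj
    rw [← h, toFun_of_le hi] at this
    omega
  · rwa [toFun_of_le hi, toFun_of_le hj] at h

theorem contains_iff {π σ : Permutation} :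
    Contains π σ ↔ ∃ f : ℕ → ℕ, (∀ i < σ.1, f i < π.1) ∧ (∀ i j, i < j → j < σ.1 → f i < f j) ∧
      ∀ i < σ.1, ∀ j < σ.1, toFun π (f i) < toFun π (f j) ↔ toFun σ i < toFun σ j := by
  constructor
  · rintro ⟨f, hf⟩
    refine ⟨fun i => if h : i < σ.1 then f ⟨i, h⟩ else 0, fun i hi => ?_, fun i j hij hj => ?_,
      fun i hi j hj => ?_⟩
    · simp [hi]
    · simp only [dif_pos hj, dif_pos (hij.trans hj)]
      exact f.strictMono hij
    · simp only [dif_pos hi, dif_pos hj]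
      rw [toFun_val, toFun_val, toFun_val σ ⟨i, hi⟩, toFun_val σ ⟨j, hj⟩]
      exact hf _ _
  · rintro ⟨f, h₁, h₂, h₃⟩
    refine ⟨OrderEmbedding.ofStrictMono (fun i => ⟨f i, h₁ i i.2⟩) fun i j hij => h₂ i j hij j.2,
      fun i j => ?_⟩
    have := h₃ i i.2 j j.2
    rw [toFun_val π ⟨f i, h₁ i i.2⟩, toFun_val π ⟨f j, h₁ j j.2⟩, toFun_val, toFun_val] at this
    exact this

theorem Contains.directSum {π π' σ σ' : Permutation} (h : Contains π π') (h' : Contains σ σ') :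
    Contains (directSum π σ) (directSum π' σ') := by
  obtain ⟨f, f₁, f₂, f₃⟩ := contains_iff.1 h
  obtain ⟨g, g₁, g₂, g₃⟩ := contains_iff.1 h'
  refine contains_iff.2 ⟨fun i => if i < π'.1 then f i else g (i - π'.1) + π.1, ?_, ?_, ?_⟩
  · intro i hi
    rw [directSum_length] at hi ⊢
    dsimp only
    split_ifs with h
    · have := f₁ i h; omega
    · have := g₁ (i - π'.1) (by omega); omega
  · intro i j hij hj
    rw [directSum_length] at hj
    dsimp only
    split_ifs with h h'
    · exact f₂ i j hij h'
    · have := f₁ i h; omega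
    · omega
    · have := g₂ (i - π'.1) (j - π'.1) (by omega) (by omega); omega
  · intro i hi j hj
    rw [directSum_length] at hi hj
    have key : ∀ i < π'.1 + σ'.1,
        toFun (PermPattern.directSum π σ) (if i < π'.1 then f i else g (i - π'.1) + π.1) =
          if i < π'.1 then toFun π (f i) else toFun σ (g (i - π'.1)) + π.1 := by
      intro i hi
      rw [toFun_directSum]
      split_ifs with h h' h'
      · rfl
      · exact absurd (f₁ i h) h'
      · omega
      · simp
    dsimp only
    rw [key i hi, key j hj, toFun_directSum, toFun_directSum]
    split_ifs with h h' h'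
    · exact f₃ i h j h'
    · have := toFun_lt (f₁ i h)
      have := toFun_lt h
      omega
    · have := toFun_lt (f₁ j h')
      have := toFun_lt h'
      omega
    · have := g₃ (i - π'.1) (by omega) (j - π'.1) (by omega)
      simpa using this

theorem contains_directSum_left (π σ : Permutation) : Contains (directSum π σ) π := by
  simpa [directSum_empty] using (Contains.refl π).directSum (contains_empty σ)

theorem contains_directSum_right (π σ : Permutation) : Contains (directSum π σ) σ := by
  simpa [empty_directSum] using (contains_empty π).directSum (Contains.refl σ)

/-! ### Unique first indecomposable summand. -/

/-- A permutation with an invariant prefix splits as a direct sum there. -/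
theorem exists_eq_directSum {π : Permutation} {k : ℕ} (hk : k ≤ π.1)
    (h : ∀ i < k, toFun π i < k) : ∃ α β : Permutation, α.1 = k ∧ π = directSum α β := by
  obtain ⟨n, π⟩ := π
  obtain ⟨m, rfl⟩ : ∃ m, n = k + m := Nat.exists_eq_add_of_le hk
  let ρ : Equiv.Perm (Fin k ⊕ Fin m) := finSumFinEquiv.trans (π.trans finSumFinEquiv.symm)
  have hρ : Set.MapsTo ρ (Set.range Sum.inl) (Set.range Sum.inl) := by
    rintro _ ⟨i, rfl⟩
    have h' := h i i.2
    have h2 := toFun_val ⟨k + m, π⟩ (Fin.castAdd m i)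
    simp only [Fin.val_castAdd] at h2
    rw [h2] at h'
    refine ⟨⟨_, h'⟩, ?_⟩
    apply finSumFinEquiv.injective
    simp [ρ]
  obtain ⟨⟨a, b⟩, hab⟩ := Equiv.Perm.mem_sumCongrHom_range_of_perm_mapsTo_inl hρ
  refine ⟨⟨k, a⟩, ⟨m, b⟩, rfl, ?_⟩
  have : Equiv.sumCongr a b = ρ := hab
  refine Sigma.ext rfl (heq_of_eq ?_)
  simp only [directSum, this]
  ext i
  simp [ρ]

/-- A nonempty permutation without a proper nonempty invariant prefix. -/
def Indec : Set Permutation :=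
  {π | 0 < π.1 ∧ ∀ k, 0 < k → k < π.1 → ¬ ∀ i < k, toFun π i < k}

theorem directSum_inj_of_length {α α' β β' : Permutation}
    (h : directSum α β = directSum α' β') (hl : α.1 = α'.1) : α = α' ∧ β = β' := by
  have hl' : β.1 = β'.1 := by
    have := congrArg Sigma.fst h
    simp only [directSum_length] at this
    omega
  have hf : ∀ i, toFun (directSum α β) i = toFun (directSum α' β') i := fun i => by rw [h]
  simp only [toFun_directSum, hl] at hf
  constructor
  · refine ext_toFun hl fun i => ?_
    rcases lt_or_ge i α'.1 with hi | hi
    · simpa [hi] using hf i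
    · rw [toFun_of_le hi, toFun_of_le (hl ▸ hi)]
  · refine ext_toFun hl' fun i => ?_
    simpa using hf (α'.1 + i)

/-- If `α` were shorter than `α'`, its length would cut off a proper invariant prefix of `α'`. -/
theorem Indec.length_le {α α' β β' : Permutation} (hα : α ∈ Indec) (hα' : α' ∈ Indec)
    (h : directSum α β = directSum α' β') : α'.1 ≤ α.1 := by
  by_contra! hlt
  refine hα'.2 α.1 hα.1 hlt fun i hi => ?_
  have hf : toFun (directSum α β) i = toFun (directSum α' β') i := by rw [h]
  rw [toFun_directSum, toFun_directSum, if_pos hi, if_pos (hi.trans hlt)] at hf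
  rw [← hf]
  exact toFun_lt hi

theorem Indec.directSum_inj {α α' β β' : Permutation} (hα : α ∈ Indec) (hα' : α' ∈ Indec)
    (h : directSum α β = directSum α' β') : α = α' ∧ β = β' :=
  directSum_inj_of_length h
    (le_antisymm (Indec.length_le hα' hα h.symm) (Indec.length_le hα hα' h))

theorem exists_indec_directSum {π : Permutation} (h : 0 < π.1) :
    ∃ α ∈ Indec, ∃ β, π = directSum α β := by
  classical
  have hex : ∃ k, 0 < k ∧ k ≤ π.1 ∧ ∀ i < k, toFun π i < k :=
    ⟨π.1, h, le_rfl, fun i hi => toFun_lt hi⟩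
  obtain ⟨h0, hle, hinv⟩ := Nat.find_spec hex
  obtain ⟨α, β, hl, hπ⟩ := exists_eq_directSum hle hinv
  refine ⟨α, ⟨hl ▸ h0, fun k hk hkα hk' => ?_⟩, β, hπ⟩
  refine Nat.find_min hex (hl ▸ hkα) ⟨hk, by omega, fun i hi => ?_⟩
  rw [hπ, toFun_directSum, if_pos (by omega)]
  exact hk' i hi

theorem Indec.eq_empty_or_eq_empty {α β : Permutation} (h : directSum α β ∈ Indec) :
    α = empty ∨ β = empty := by
  by_contra! hne
  have hα : 0 < α.1 := Nat.pos_of_ne_zero fun h => hne.1 (eq_empty_of_length_eq_zero h)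
  have hβ : 0 < β.1 := Nat.pos_of_ne_zero fun h => hne.2 (eq_empty_of_length_eq_zero h)
  refine h.2 α.1 hα (by rw [directSum_length]; omega) fun i hi => ?_
  rw [toFun_directSum, if_pos hi]
  exact toFun_lt hi

/-- A pattern of a direct sum is a direct sum of patterns. -/
theorem Contains.exists_of_directSum {α β τ : Permutation}
    (h : Contains (PermPattern.directSum α β) τ) :
    ∃ α' β', τ = PermPattern.directSum α' β' ∧ Contains α α' ∧ Contains β β' := by
  classical
  obtain ⟨f, f₁, f₂, f₃⟩ := contains_iff.1 h
  rw [directSum_length] at f₁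
  obtain ⟨k, hk, hk₁, hk₂⟩ : ∃ k ≤ τ.1, (∀ i < k, f i < α.1) ∧
      ∀ i, k ≤ i → i < τ.1 → α.1 ≤ f i := by
    have hex : ∃ k, k = τ.1 ∨ k < τ.1 ∧ α.1 ≤ f k := ⟨τ.1, Or.inl rfl⟩
    have hs := Nat.find_spec hex
    have hm := fun i => Nat.find_min (m := i) hex
    generalize Nat.find hex = k at hs hm
    refine ⟨k, by omega, fun i hi => ?_, fun i hki hi => ?_⟩
    · have := hm i hi
      omega
    · rcases hki.eq_or_lt with rfl | hlt
      · omega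
      · have := f₂ k i hlt hi
        omega
  have hlt : ∀ i < k, ∀ j, k ≤ j → j < τ.1 → toFun τ i < toFun τ j := by
    intro i hi j hkj hj
    rw [← f₃ i (by omega) j hj, toFun_directSum, toFun_directSum, if_pos (hk₁ i hi),
      if_neg (not_lt.2 (hk₂ j hkj hj))]
    have := toFun_lt (hk₁ i hi)
    omega
  have hinv : ∀ i < k, toFun τ i < k := by
    intro i hi
    -- The `τ.1 - k` later entries take distinct values above `toFun τ i`, which forces `toFun τ i <
    -- k`.
    have hc : (Finset.Ico k τ.1).card ≤ (Finset.Ioo (toFun τ i) τ.1).card := by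
      refine Finset.card_le_card_of_injOn (toFun τ) (fun j hj => ?_)
        (toFun_injective τ).injOn
      simp only [Finset.coe_Ico, Set.mem_Ico] at hj
      simp only [Finset.coe_Ioo, Set.mem_Ioo]
      exact ⟨hlt i hi j hj.1 hj.2, toFun_lt hj.2⟩
    have := toFun_lt (π := τ) (i := i) (by omega)
    rw [Nat.card_Ico, Nat.card_Ioo] at hc
    omega
  obtain ⟨α', β', rfl, rfl⟩ := exists_eq_directSum hk hinv
  rw [directSum_length] at f₂ f₃ hk₂
  simp only [directSum_length] at f₁
  refine ⟨α', β', rfl, contains_iff.2 ⟨f, hk₁, fun i j hij hj => f₂ i j hij (by omega),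
    fun i hi j hj => ?_⟩, contains_iff.2 ⟨fun i => f (α'.1 + i) - α.1, fun i hi => ?_,
    fun i j hij hj => ?_, fun i hi j hj => ?_⟩⟩
  · have := f₃ i (by omega) j (by omega)
    simpa only [toFun_directSum, if_pos hi, if_pos hj, if_pos (hk₁ i hi), if_pos (hk₁ j hj)]
      using this
  · have h₁ := f₁ (α'.1 + i) (by omega)
    have h₂ := hk₂ (α'.1 + i) (by omega) (by omega)
    dsimp only
    omega
  · have h₁ := f₂ (α'.1 + i) (α'.1 + j) (by omega) (by omega)
    have h₂ := hk₂ (α'.1 + i) (by omega) (by omega)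
    dsimp only
    omega
  · have h₁ := f₃ (α'.1 + i) (by omega) (α'.1 + j) (by omega)
    have h₂ := hk₂ (α'.1 + i) (by omega) (by omega)
    have h₃ := hk₂ (α'.1 + j) (by omega) (by omega)
    simpa [toFun_directSum, not_lt.2 h₂, not_lt.2 h₃] using h₁

theorem isPermClass_setSum {D E : Set Permutation} (hD : IsPermClass D) (hE : IsPermClass E) :
    IsPermClass (setSum D E) := by
  rintro _ ⟨α, hα, β, hβ, rfl⟩ τ hτ
  obtain ⟨α', β', rfl, h₁, h₂⟩ := hτ.exists_of_directSum
  exact ⟨α', hD α hα _ h₁, β', hE β hβ _ h₂, rfl⟩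

/-! ### Generating functions. -/

/-- The members of `C` of length `n`. -/
def level (C : Set Permutation) (n : ℕ) : Set Permutation := {π ∈ C | π.1 = n}

theorem level_eq_image (C : Set Permutation) (n : ℕ) :
    level C n = Sigma.mk n '' {π : Equiv.Perm (Fin n) | (⟨n, π⟩ : Permutation) ∈ C} := by
  ext π
  constructor
  · rintro ⟨h, rfl⟩
    exact ⟨π.2, h, rfl⟩
  · rintro ⟨σ, h, rfl⟩
    exact ⟨h, rfl⟩

theorem level_finite (C : Set Permutation) (n : ℕ) : (level C n).Finite := by
  rw [level_eq_image]
  exact (Set.toFinite _).image _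

theorem ncard_level (C : Set Permutation) (n : ℕ) : (level C n).ncard = count C n := by
  rw [level_eq_image, Set.ncard_image_of_injective _ sigma_mk_injective, count]

/-- The generating function of `C`, with the empty permutation counted. -/
noncomputable def ogf (C : Set Permutation) : ℚ⟦X⟧ := PowerSeries.mk fun n => (count C n : ℚ)

theorem coeff_ogf (C : Set Permutation) (n : ℕ) :
    PowerSeries.coeff n (ogf C) = (level C n).ncard := by
  rw [ogf, PowerSeries.coeff_mk, ncard_level]

theorem genFun_eq (C : Set Permutation) :
    genFun C = ogf C - PowerSeries.C (count C 0 : ℚ) := by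
  ext n
  rw [genFun, ogf, map_sub, PowerSeries.coeff_mk, PowerSeries.coeff_mk, PowerSeries.coeff_C]
  split_ifs with h <;> simp [h]

theorem ogf_union {A B : Set Permutation} (h : Disjoint A B) : ogf (A ∪ B) = ogf A + ogf B := by
  ext n
  have hu : level (A ∪ B) n = level A n ∪ level B n := by
    ext π; simp only [level, Set.mem_union, Set.mem_ofPred_eq]; tauto
  rw [map_add, coeff_ogf, coeff_ogf, coeff_ogf, hu, Set.ncard_union_eq
    (h.mono (fun _ h => h.1) fun _ h => h.1) (level_finite A n) (level_finite B n)]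
  push_cast
  rfl

theorem ogf_empty : ogf ∅ = 0 := by
  ext n
  simp [coeff_ogf, level]

theorem ogf_diff {A B : Set Permutation} (h : A ⊆ B) : ogf (B \ A) = ogf B - ogf A := by
  rw [eq_sub_iff_add_eq, ← ogf_union Set.disjoint_sdiff_left, Set.sdiff_union_of_subset h]

theorem ogf_union_add_inter (A B : Set Permutation) :
    ogf (A ∪ B) = ogf A + ogf B - ogf (A ∩ B) := by
  rw [← Set.union_sdiff_self, ogf_union Set.disjoint_sdiff_right, ← Set.sdiff_inter_self_eq_sdiff,
    ogf_diff Set.inter_subset_right, add_sub_assoc]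

theorem ogf_biUnion {ι : Type*} (t : Finset ι) (s : ι → Set Permutation)
    (h : (t : Set ι).PairwiseDisjoint s) : ogf (⋃ i ∈ t, s i) = ∑ i ∈ t, ogf (s i) := by
  classical
  induction t using Finset.induction_on with
  | empty => simp [ogf_empty]
  | insert a t ha ih =>
    rw [Finset.set_biUnion_insert, ogf_union, Finset.sum_insert ha,
      ih (h.subset (by simp))]
    rw [Set.disjoint_iUnion₂_right]
    intro i hi
    exact h (by simp) (by simp [hi]) (by rintro rfl; exact ha hi)

theorem ogf_singleton_empty : ogf {empty} = 1 := by
  ext n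
  rw [coeff_ogf, PowerSeries.coeff_one]
  split_ifs with h
  · have : level {empty} n = {empty} := by
      ext π
      simp only [level, Set.mem_ofPred_eq, Set.mem_singleton_iff, and_iff_left_iff_imp]
      rintro rfl
      exact h.symm
    simp [this]
  · have : level {empty} n = ∅ := by
      ext π
      simp only [level, Set.mem_ofPred_eq, Set.mem_singleton_iff, Set.mem_empty_iff_false,
        iff_false, not_and]
      rintro rfl
      exact fun h' => h h'.symm
    simp [this]

theorem ogf_ne_zero {C : Set Permutation} {π : Permutation} (h : π ∈ C) : ogf C ≠ 0 := by
  intro h0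
  have := coeff_ogf C π.1
  rw [h0, map_zero, eq_comm, Nat.cast_eq_zero, Set.ncard_eq_zero (level_finite _ _)] at this
  exact (this ▸ (⟨h, rfl⟩ : π ∈ level C π.1) : π ∈ (∅ : Set Permutation))

theorem constantCoeff_ogf {A : Set Permutation} (h : A ⊆ Indec) :
    PowerSeries.constantCoeff (ogf A) = 0 := by
  rw [← PowerSeries.coeff_zero_eq_constantCoeff_apply, coeff_ogf, Nat.cast_eq_zero,
    Set.ncard_eq_zero (level_finite _ _), Set.eq_empty_iff_forall_notMem]
  rintro π ⟨hπ, h0⟩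
  exact (h hπ).1.ne' h0

/-- With an indecomposable first summand, `π ⊕ σ` determines both summands, so lengths convolve
without overcounting. -/
theorem ogf_setSum {A : Set Permutation} (hA : A ⊆ Indec) (B : Set Permutation) :
    ogf (setSum A B) = ogf A * ogf B := by
  classical
  ext n
  rw [PowerSeries.coeff_mul, coeff_ogf]
  let lev (C : Set Permutation) (n : ℕ) : Finset Permutation := (level_finite C n).toFinset
  have hlev : ∀ C n, (level C n).ncard = (lev C n).card := fun C n =>
    Set.ncard_eq_toFinset_card _ _
  have mem_lev : ∀ C n π, π ∈ lev C n ↔ π ∈ C ∧ π.1 = n := fun C n π => by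
    simp [lev, level]
  let T := (Finset.HasAntidiagonal.antidiagonal n).biUnion fun p => lev A p.1 ×ˢ lev B p.2
  have mem_T : ∀ p, p ∈ T ↔ p.1 ∈ A ∧ p.2 ∈ B ∧ p.1.1 + p.2.1 = n := by
    intro p
    simp only [T, Finset.mem_biUnion, Finset.mem_product, mem_lev, Finset.HasAntidiagonal.mem_antidiagonal]
    constructor
    · rintro ⟨q, h, ⟨h₁, h₂⟩, h₃, h₄⟩
      exact ⟨h₁, h₃, by omega⟩
    · rintro ⟨h₁, h₂, h₃⟩
      exact ⟨(p.1.1, p.2.1), h₃, ⟨h₁, rfl⟩, h₂, rfl⟩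
  have hT : lev (setSum A B) n = T.image fun p => directSum p.1 p.2 := by
    ext π
    rw [mem_lev, Finset.mem_image]
    constructor
    · rintro ⟨⟨α, hα, β, hβ, rfl⟩, h⟩
      exact ⟨(α, β), (mem_T _).2 ⟨hα, hβ, h⟩, rfl⟩
    · rintro ⟨p, hp, rfl⟩
      obtain ⟨hα, hβ, h⟩ := (mem_T _).1 hp
      exact ⟨⟨p.1, hα, p.2, hβ, rfl⟩, h⟩
  rw [hlev, hT, Finset.card_image_of_injOn, Finset.card_biUnion]
  · push_cast
    refine Finset.sum_congr rfl fun p _ => ?_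
    rw [Finset.card_product, coeff_ogf, coeff_ogf, hlev, hlev]
    push_cast
    rfl
  · intro p _ q _ hpq
    rw [Function.onFun, Finset.disjoint_left]
    intro r hr hr'
    rw [Finset.mem_product, mem_lev, mem_lev] at hr hr'
    exact hpq (Prod.ext (hr.1.2.symm.trans hr'.1.2) (hr.2.2.symm.trans hr'.2.2))
  · intro p hp q hq h
    obtain ⟨h₁, h₂⟩ := Indec.directSum_inj (hA ((mem_T _).1 hp).1) (hA ((mem_T _).1 hq).1) h
    exact Prod.ext h₁ h₂

/-! ### Rational power series. -/

/-- The rational power series form a subring. -/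
def rationalSubring : Subring ℚ⟦X⟧ where
  carrier := {f | IsRationalSeries f}
  one_mem' := ⟨1, 1, one_ne_zero, by simp⟩
  zero_mem' := ⟨0, 1, one_ne_zero, by simp⟩
  neg_mem' := by
    rintro f ⟨p, q, hq, h⟩
    exact ⟨-p, q, hq, by rw [mul_neg, h, Polynomial.coe_neg]⟩
  add_mem' := by
    rintro f g ⟨p, q, hq, h⟩ ⟨p', q', hq', h'⟩
    refine ⟨p * q' + p' * q, q * q', mul_ne_zero hq hq', ?_⟩
    simp only [Polynomial.coe_add, Polynomial.coe_mul, ← h, ← h']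
    ring
  mul_mem' := by
    rintro f g ⟨p, q, hq, h⟩ ⟨p', q', hq', h'⟩
    refine ⟨p * p', q * q', mul_ne_zero hq hq', ?_⟩
    simp only [Polynomial.coe_mul, ← h, ← h']
    ring

theorem mem_rationalSubring {f : ℚ⟦X⟧} : f ∈ rationalSubring ↔ IsRationalSeries f := Iff.rfl

theorem C_mem_rationalSubring (a : ℚ) : PowerSeries.C a ∈ rationalSubring :=
  ⟨Polynomial.C a, 1, one_ne_zero, by simp⟩

theorem mem_rationalSubring_of_mul {s f : ℚ⟦X⟧} (hs : s ∈ rationalSubring) (h0 : s ≠ 0)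
    (h : s * f ∈ rationalSubring) : f ∈ rationalSubring := by
  obtain ⟨p, q, hq, h₁⟩ := hs
  obtain ⟨p', q', hq', h₂⟩ := h
  have hp : p ≠ 0 := by
    rintro rfl
    rw [Polynomial.coe_zero, mul_eq_zero, Polynomial.coe_eq_zero_iff] at h₁
    tauto
  refine ⟨q * p', q' * p, mul_ne_zero hq' hp, ?_⟩
  simp only [Polynomial.coe_mul, ← h₁, ← h₂]
  ring

theorem isRationalSeries_genFun_iff {C : Set Permutation} :
    IsRationalSeries (genFun C) ↔ ogf C ∈ rationalSubring := by
  rw [← mem_rationalSubring, genFun_eq]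
  exact ⟨fun h => by simpa using add_mem h (C_mem_rationalSubring (count C 0 : ℚ)),
    fun h => sub_mem h (C_mem_rationalSubring _)⟩

theorem countable_isRationalSeries : {f | IsRationalSeries f}.Countable := by
  have : Countable ℚ[X] := by
    rw [← Cardinal.mk_le_aleph0_iff]
    exact Polynomial.cardinalMk_le_max.trans (by simp)
  choose p q hq h using fun f : {f | IsRationalSeries f} => f.2
  refine Set.countable_coe_iff.1 (Function.Injective.countable (f := fun f => (p f, q f)) ?_)
  intro f g hfg
  obtain ⟨h₁, h₂⟩ := Prod.ext_iff.1 hfg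
  dsimp only at h₁ h₂
  have := (h f).trans ((congrArg _ h₁).trans (h g).symm)
  rw [h₂] at this
  exact Subtype.ext (mul_left_cancel₀
    (fun h0 => hq g (Polynomial.coe_eq_zero_iff.1 h0)) this)

/-! ### Strong rationality implies partial well order. -/

theorem finite_length_le (n : ℕ) : {π : Permutation | π.1 ≤ n}.Finite := by
  refine ((Set.finite_le_nat n).biUnion fun k _ => level_finite Set.univ k).subset fun π hπ => ?_
  simp only [Set.mem_iUnion]
  exact ⟨π.1, hπ, trivial, rfl⟩

/-- A set that is not partially well ordered contains an antichain with members of strictly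
increasing lengths. -/
theorem exists_antichain {U : Set Permutation} (h : ¬ U.PartiallyWellOrderedOn Embeds) :
    ∃ x : ℕ → Permutation, (∀ i, x i ∈ U) ∧ StrictMono (fun i => (x i).1) ∧
      ∀ i j, Contains (x j) (x i) → i = j := by
  rw [Set.partiallyWellOrderedOn_iff_exists_lt] at h
  push Not at h
  obtain ⟨f, hfU, hf⟩ := h
  obtain ⟨g, hg | hg⟩ := exists_increasing_or_nonincreasing_subseq (· < ·) (fun n => (f n).1)
  · refine ⟨fun i => f (g i), fun i => hfU _, fun i j hij => hg i j hij, fun i j hij => ?_⟩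
    rcases lt_trichotomy i j with h | h | h
    · exact absurd hij (hf _ _ (g.strictMono h))
    · exact h
    · exact absurd hij.length_le (not_le.2 (hg j i h))
  -- A bad sequence is injective, but here all lengths are bounded by the first one.
  · exfalso
    have hinj : Function.Injective fun i => f (g i) := by
      intro i j hij
      dsimp only at hij
      by_contra hne
      rcases lt_or_gt_of_ne hne with h | h <;>
        exact hf _ _ (g.strictMono h) (by rw [hij]; exact refl_of Embeds _)
    refine Set.infinite_range_of_injective hinj ((finite_length_le (f (g 0)).1).subset ?_)
    rintro _ ⟨i, rfl⟩
    rcases Nat.eq_zero_or_pos i with rfl | hi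
    · exact le_refl (f (g 0)).1
    · exact not_lt.1 (hg 0 i hi)

theorem StronglyRational.partiallyWellOrderedOn {U : Set Permutation} (hU : StronglyRational U) :
    U.PartiallyWellOrderedOn Embeds := by
  by_contra hnot
  obtain ⟨x, hxU, hmono, hanti⟩ := exists_antichain hnot
  -- The permutations below the antichain that avoid `x i` for every `i ∉ S`; the generating
  -- function will determine `S`.
  let C : Set ℕ → Set Permutation := fun S =>
    {σ | (∃ j, Contains (x j) σ) ∧ ∀ i ∉ S, ¬ Contains σ (x i)}
  have hCU : ∀ S, C S ⊆ U := by
    rintro S σ ⟨⟨j, hj⟩, -⟩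
    exact hU.1 _ (hxU j) _ hj
  have hC : ∀ S, IsPermClass (C S) := by
    rintro S σ ⟨⟨j, hj⟩, h⟩ τ hτ
    exact ⟨⟨j, hj.trans hτ⟩, fun i hi hi' => h i hi (hτ.trans hi')⟩
  -- Needed because `genFun` discards the coefficient at length zero.
  have hpos : ∀ i, (x i).1 ≠ 0 := fun i hi => by
    have := hanti i (i + 1) (by rw [eq_empty_of_length_eq_zero hi]; exact contains_empty _)
    omega
  have hmem : ∀ S i, i ∈ S ↔ count (C S) (x i).1 = count (C Set.univ) (x i).1 := by
    intro S i
    have hsub : level (C S) (x i).1 ⊆ level (C Set.univ) (x i).1 :=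
      fun σ hσ => ⟨⟨hσ.1.1, fun i hi => absurd trivial hi⟩, hσ.2⟩
    rw [← ncard_level, ← ncard_level]
    constructor
    · intro hi
      congr 1
      -- If `σ` contains a forbidden `x k`, then `σ` lies between `x k` and some `x j`. The
      -- antichain gives `j = k`, so `σ` has the length of `x k`, and strict growth of lengths gives
      -- `k = i ∈ S`.
      refine hsub.antisymm fun σ hσ => ⟨⟨hσ.1.1, fun k hk hk' => hk ?_⟩, hσ.2⟩
      obtain ⟨j, hj⟩ := hσ.1.1
      obtain rfl := hanti _ _ (hj.trans hk')
      have h₁ : (x i).1 ≤ (x k).1 := hσ.2 ▸ hj.length_le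
      have h₂ : (x k).1 ≤ (x i).1 := hσ.2 ▸ hk'.length_le
      rwa [hmono.injective (le_antisymm h₂ h₁)]
    · intro h
      have := Set.eq_of_subset_of_ncard_le hsub h.ge (level_finite _ _)
      have hx : x i ∈ level (C S) (x i).1 := by
        rw [this]
        exact ⟨⟨⟨i, Contains.refl _⟩, fun i hi => absurd trivial hi⟩, rfl⟩
      by_contra hi
      exact hx.1.2 i hi (Contains.refl _)
  have hinj : Function.Injective fun S => (⟨genFun (C S), hU.2 _ (hCU S) (hC S)⟩ :
      {f | IsRationalSeries f}) := by
    intro S S' h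
    have h := congrArg Subtype.val h
    dsimp only at h
    ext i
    have h' := congrArg (PowerSeries.coeff (x i).1) h
    simp only [genFun, PowerSeries.coeff_mk, if_neg (hpos i), Nat.cast_inj] at h'
    rw [hmem, hmem, h']
  have := countable_isRationalSeries.to_subtype
  obtain ⟨e, he⟩ := exists_injective_nat {f | IsRationalSeries f}
  exact Function.cantor_injective _ (he.comp hinj)

/-! ### Descending chain condition and fibers. -/

variable {W : Set Permutation}

/-- Subclasses of a partially well ordered set satisfy the descending chain condition. -/
theorem not_strictAnti_of_partiallyWellOrderedOn (hW : W.PartiallyWellOrderedOn Embeds)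
    {V : ℕ → Set Permutation} (hV : ∀ n, IsPermClass (V n)) (hVW : ∀ n, V n ⊆ W)
    (h : StrictAnti V) : False := by
  choose x hx hx' using fun n : ℕ => Set.exists_of_ssubset (h n.lt_succ_self)
  obtain ⟨m, n, hmn, hle⟩ := hW.exists_lt fun n => hVW n (hx n)
  exact hx' m (hV _ _ (h.antitone (Nat.succ_le_of_lt hmn) (hx n)) _ hle)

theorem class_induction (hW : W.PartiallyWellOrderedOn Embeds) {P : Set Permutation → Prop}
    (h : ∀ C ⊆ W, IsPermClass C → (∀ D, D ⊂ C → IsPermClass D → P D) → P C) :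
    ∀ C ⊆ W, IsPermClass C → P C := by
  have hwf : WellFounded fun A B : {C : Set Permutation // C ⊆ W ∧ IsPermClass C} => A < B := by
    rw [RelEmbedding.wellFounded_iff_isEmpty]
    refine ⟨fun f => not_strictAnti_of_partiallyWellOrderedOn hW (V := fun n => (f n).1)
      (fun n => (f n).2.2) (fun n => (f n).2.1) fun m n hmn => f.map_rel_iff.2 hmn⟩
  intro C hCW hC
  refine hwf.induction (C := fun A => P A.1) ⟨C, hCW, hC⟩ ?_
  rintro ⟨C, hCW, hC⟩ ih
  exact h C hCW hC fun D hD hDc => ih ⟨D, hD.subset.trans hCW, hDc⟩ hD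

/-- The permutations that may follow `α` in `C`. -/
def fiber (C : Set Permutation) (α : Permutation) : Set Permutation := {β | directSum α β ∈ C}

theorem isPermClass_fiber {C : Set Permutation} (hC : IsPermClass C) (α : Permutation) :
    IsPermClass (fiber C α) :=
  fun β hβ _ hσ => hC (directSum α β) hβ _ ((Contains.refl α).directSum hσ)

theorem fiber_subset {C : Set Permutation} (hC : IsPermClass C) (α : Permutation) :
    fiber C α ⊆ C :=
  fun β hβ => hC (directSum α β) hβ _ (contains_directSum_right α β)

theorem fiber_anti {C : Set Permutation} (hC : IsPermClass C) {α α' : Permutation}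
    (h : Contains α α') : fiber C α ⊆ fiber C α' :=
  fun β hβ => hC (directSum α β) hβ _ (h.directSum (Contains.refl β))

theorem empty_mem_fiber {C : Set Permutation} {α : Permutation} (h : α ∈ C) :
    empty ∈ fiber C α := by
  rwa [fiber, Set.mem_ofPred_eq, directSum_empty]

/-- Fibers shrink as `α` grows. Infinitely many of them would give, along a monotone subsequence of
the `α`, a strictly descending chain of classes. -/
theorem finite_fiber (hW : W.PartiallyWellOrderedOn Embeds) {C : Set Permutation} (hCW : C ⊆ W)
    (hC : IsPermClass C) {A : Set Permutation} (hA : A ⊆ C) : (fiber C '' A).Finite := by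
  by_contra hinf
  let e := Set.Infinite.natEmbedding _ hinf
  choose α hα hαe using fun n => (e n).2
  obtain ⟨g, hg⟩ := hW.exists_monotone_subseq fun n => hCW (hA (hα n))
  refine not_strictAnti_of_partiallyWellOrderedOn hW (V := fun n => fiber C (α (g n)))
    (fun n => isPermClass_fiber hC _) (fun n => (fiber_subset hC _).trans hCW) fun m n hmn => ?_
  refine lt_of_le_of_ne (fiber_anti hC (hg m n hmn.le)) fun heq => ?_
  exact hmn.ne' (g.injective (e.injective
    (Subtype.ext ((hαe _).symm.trans (heq.trans (hαe _))))))

/-! ### Sum completions as sums of lists. -/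

/-- The direct sum of a list of permutations. -/
def sumList (l : List Permutation) : Permutation := l.foldr directSum empty

theorem sumList_cons (π : Permutation) (l : List Permutation) :
    sumList (π :: l) = directSum π (sumList l) := rfl

theorem sumList_append (l l' : List Permutation) :
    sumList (l ++ l') = directSum (sumList l) (sumList l') := by
  induction l with
  | nil => exact (empty_directSum _).symm
  | cons π l ih => rw [List.cons_append, sumList_cons, ih, sumList_cons, directSum_assoc]

theorem contains_sumList {l l' : List Permutation} (h : List.SublistForall₂ Embeds l l') :
    Contains (sumList l') (sumList l) := by
  induction h with
  | nil => exact contains_empty _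
  | cons h _ ih => exact Contains.directSum h ih
  | cons_right _ ih => exact (contains_directSum_right _ _).trans ih

/-- The list sums over `U` themselves form a sum closed class containing `U`, so minimality applies.
-/
theorem exists_sumList {U : Set Permutation} (hU : IsPermClass U) {π : Permutation}
    (h : π ∈ sumCompletion U) : ∃ l : List Permutation, (∀ σ ∈ l, σ ∈ U) ∧ sumList l = π := by
  refine h {π | ∃ l : List Permutation, (∀ σ ∈ l, σ ∈ U) ∧ sumList l = π} ⟨?_, ?_, ?_⟩
  · rintro _ ⟨l, hl, rfl⟩ τ hτ
    induction l generalizing τ with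
    | nil => exact ⟨[], by simp, (eq_empty_of_length_eq_zero (Nat.le_zero.1 hτ.length_le)).symm⟩
    | cons α l ih =>
      obtain ⟨α', β', rfl, h₁, h₂⟩ := Contains.exists_of_directSum hτ
      obtain ⟨l', hl', rfl⟩ := ih (fun σ hσ => hl σ (List.mem_cons_of_mem _ hσ)) _ h₂
      refine ⟨α' :: l', ?_, rfl⟩
      simp only [List.mem_cons, forall_eq_or_imp]
      exact ⟨hU _ (hl α List.mem_cons_self) _ h₁, hl'⟩
  · rintro _ ⟨_, ⟨l, hl, rfl⟩, _, ⟨l', hl', rfl⟩, rfl⟩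
    refine ⟨l ++ l', fun σ hσ => ?_, sumList_append l l'⟩
    rcases List.mem_append.1 hσ with h | h
    exacts [hl σ h, hl' σ h]
  · intro π hπ
    exact ⟨[π], by simpa using hπ, directSum_empty π⟩

theorem sumCompletion_inter_indec {U : Set Permutation} (hU : IsPermClass U) :
    sumCompletion U ∩ Indec ⊆ U := by
  rintro π ⟨hπ, hi⟩
  obtain ⟨l, hl, rfl⟩ := exists_sumList hU hπ
  clear hπ
  induction l with
  | nil => exact absurd hi.1 (lt_irrefl 0)
  | cons α l ih =>
    rw [sumList_cons] at hi ⊢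
    rcases Indec.eq_empty_or_eq_empty hi with h | h
    · rw [h, empty_directSum] at hi ⊢
      exact ih (fun σ hσ => hl σ (List.mem_cons_of_mem _ hσ)) hi
    · rw [h, directSum_empty]
      exact hl α List.mem_cons_self

/-- Higman's lemma for lists over `U`, transported along `sumList`, which is monotone by
`contains_sumList`. -/
theorem partiallyWellOrderedOn_sumCompletion {U : Set Permutation} (hU : IsPermClass U)
    (h : U.PartiallyWellOrderedOn Embeds) :
    (sumCompletion U).PartiallyWellOrderedOn Embeds := by
  rw [Set.partiallyWellOrderedOn_iff_exists_lt]
  intro f hf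
  choose l hl hlf using fun n => exists_sumList hU (hf n)
  obtain ⟨m, n, hmn, hle⟩ :=
    (Set.PartiallyWellOrderedOn.partiallyWellOrderedOn_sublistForall₂ Embeds h).exists_lt hl
  refine ⟨m, n, hmn, ?_⟩
  rw [← hlf, ← hlf]
  exact contains_sumList hle

/-! ### Splitting off the first summand. -/

/-- The indecomposable members `α` of `C` with fiber `V`. -/
def indecFiber (C V : Set Permutation) : Set Permutation := {α ∈ C ∩ Indec | fiber C α = V}

theorem pairwiseDisjoint_indecFiber (C : Set Permutation) (t : Set (Set Permutation)) :
    t.PairwiseDisjoint (indecFiber C) := by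
  intro V _ V' _ hne
  rw [Function.onFun, Set.disjoint_left]
  rintro α ⟨_, h⟩ ⟨_, h'⟩
  exact hne (h.symm.trans h')

theorem biUnion_indecFiber {C : Set Permutation} {T : Finset (Set Permutation)}
    (hT : ∀ α ∈ C ∩ Indec, fiber C α ∈ T) : ⋃ V ∈ T, indecFiber C V = C ∩ Indec := by
  ext α
  simp only [Set.mem_iUnion]
  exact ⟨fun ⟨_, _, h⟩ => h.1, fun h => ⟨_, hT α h, h, rfl⟩⟩

/-- Splitting off the first indecomposable summand. -/
theorem ogf_eq_sum {C : Set Permutation} (hC : IsPermClass C) (h0 : empty ∈ C)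
    {T : Finset (Set Permutation)} (hT : ∀ α ∈ C ∩ Indec, fiber C α ∈ T) :
    ogf C = 1 + ∑ V ∈ T, ogf (indecFiber C V) * ogf V := by
  have hsub : ∀ V, indecFiber C V ⊆ Indec := fun V α h => h.1.2
  have hdecomp : C = {empty} ∪ ⋃ V ∈ T, setSum (indecFiber C V) V := by
    ext π
    simp only [Set.mem_union, Set.mem_iUnion, Set.mem_singleton_iff]
    constructor
    · intro hπ
      rcases Nat.eq_zero_or_pos π.1 with h | h
      · exact Or.inl (eq_empty_of_length_eq_zero h)
      · obtain ⟨α, hα, β, rfl⟩ := exists_indec_directSum h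
        have hαC : α ∈ C ∩ Indec := ⟨hC _ hπ _ (contains_directSum_left α β), hα⟩
        exact Or.inr ⟨_, hT α hαC, α, ⟨hαC, rfl⟩, β, hπ, rfl⟩
    · rintro (rfl | ⟨_, _, α, ⟨_, rfl⟩, β, hβ, rfl⟩)
      exacts [h0, hβ]
  conv_lhs => rw [hdecomp]
  rw [ogf_union, ogf_singleton_empty, ogf_biUnion]
  · simp only [ogf_setSum (hsub _)]
  · intro V _ V' _ hne
    rw [Function.onFun, Set.disjoint_left]
    rintro _ ⟨α, hα, β, _, rfl⟩ ⟨α', hα', β', _, h⟩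
    obtain ⟨rfl, -⟩ := Indec.directSum_inj hα.1.2 hα'.1.2 h
    exact hne (hα.2.symm.trans hα'.2)
  · rw [Set.disjoint_singleton_left]
    simp only [Set.mem_iUnion]
    rintro ⟨V, _, α, hα, β, _, h⟩
    have h₁ : α.1 + β.1 = 0 := (congrArg Sigma.fst h).symm
    have := hα.1.2.1
    omega

/-- The members `α` of `C` whose fiber contains `V`. -/
def fiberGe (C V : Set Permutation) : Set Permutation := {α ∈ C | V ⊆ fiber C α}

/-- The members `α` of `C` whose fiber properly contains `V`. -/
def fiberGt (C V : Set Permutation) : Set Permutation := {α ∈ C | V ⊂ fiber C α}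

theorem isPermClass_fiberGe {C : Set Permutation} (hC : IsPermClass C) (V : Set Permutation) :
    IsPermClass (fiberGe C V) :=
  fun α hα σ hσ => ⟨hC α hα.1 σ hσ, hα.2.trans (fiber_anti hC hσ)⟩

theorem isPermClass_fiberGt {C : Set Permutation} (hC : IsPermClass C) (V : Set Permutation) :
    IsPermClass (fiberGt C V) :=
  fun α hα σ hσ => ⟨hC α hα.1 σ hσ, hα.2.trans_subset (fiber_anti hC hσ)⟩

/-- Having fiber exactly `V` does not define a class, but it is a difference of two conditions that
do; this makes induction on classes applicable. -/
theorem ogf_indecFiber (C V : Set Permutation) :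
    ogf (indecFiber C V) = ogf (fiberGe C V ∩ Indec) - ogf (fiberGt C V ∩ Indec) := by
  have hsub : fiberGt C V ∩ Indec ⊆ fiberGe C V ∩ Indec :=
    fun α h => ⟨⟨h.1.1, h.1.2.subset⟩, h.2⟩
  rw [← ogf_diff hsub]
  congr 1
  ext α
  simp only [indecFiber, fiberGe, fiberGt, Set.mem_sdiff, Set.mem_inter_iff, Set.mem_ofPred_eq,
    ssubset_iff_subset_ne]
  constructor
  · rintro ⟨⟨h₁, h₂⟩, rfl⟩
    exact ⟨⟨⟨h₁, subset_rfl⟩, h₂⟩, fun h => h.1.2.2 rfl⟩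
  · rintro ⟨⟨⟨h₁, h₂⟩, h₃⟩, h₄⟩
    refine ⟨⟨h₁, h₃⟩, ?_⟩
    by_contra hne
    exact h₄ ⟨⟨h₁, h₂, fun h => hne h.symm⟩, h₃⟩

theorem StronglyRational.ogf_mem {U C : Set Permutation} (hU : StronglyRational U) (hCU : C ⊆ U)
    (hC : IsPermClass C) : ogf C ∈ rationalSubring :=
  isRationalSeries_genFun_iff.1 (hU.2 C hCU hC)

/-! ### Rationality by induction on subclasses. -/

/-- The sum indecomposable members of a subclass of a strongly rational class have a rational
generating function. -/
theorem StronglyRational.ogf_inter_indec_mem {U : Set Permutation} (hU : StronglyRational U) :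
    ∀ C ⊆ U, IsPermClass C → ogf (C ∩ Indec) ∈ rationalSubring := by
  classical
  refine class_induction hU.partiallyWellOrderedOn fun C hCU hC ih => ?_
  have hfin := finite_fiber hU.partiallyWellOrderedOn hCU hC (A := C ∩ Indec) Set.inter_subset_left
  let T := hfin.toFinset
  have mem_T : ∀ V, V ∈ T ↔ ∃ α ∈ C ∩ Indec, fiber C α = V := fun V => by simp [T]
  have hT : ∀ α ∈ C ∩ Indec, fiber C α ∈ T := fun α hα => (mem_T _).2 ⟨α, hα, rfl⟩
  -- `fiberGt C V` is a proper subclass: it misses every `α` whose fiber is `V`.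
  have hgt : ∀ V ∈ T, ogf (fiberGt C V ∩ Indec) ∈ rationalSubring := by
    intro V hV
    obtain ⟨α, hα, rfl⟩ := (mem_T V).1 hV
    refine ih _ ?_ (isPermClass_fiberGt hC _)
    refine ⟨fun β h => h.1, fun h => ?_⟩
    exact ssubset_irrefl _ (h hα.1).2
  have hpiece : ∀ V ∈ T, fiberGe C V ≠ C → ogf (indecFiber C V) ∈ rationalSubring := by
    intro V hV hne
    rw [ogf_indecFiber]
    exact sub_mem (ih _ (ssubset_of_subset_of_ne (fun β h => h.1) hne) (isPermClass_fiberGe hC V))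
      (hgt V hV)
  by_cases hex : ∃ V₀ ∈ T, fiberGe C V₀ = C
  · obtain ⟨V₀, hV₀, hge⟩ := hex
    -- `fiberGe C V = C` says that `V` is the least fiber, so only one `V` escapes the induction
    -- hypothesis. The sum formula is then solved for `ogf (C ∩ Indec)`, whose coefficient `ogf V₀`
    -- is nonzero.
    have huniq : ∀ V ∈ T, V ≠ V₀ → fiberGe C V ≠ C := by
      rintro V hV hne hV'
      obtain ⟨α, hα, rfl⟩ := (mem_T V).1 hV
      obtain ⟨α₀, hα₀, rfl⟩ := (mem_T V₀).1 hV₀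
      exact hne ((hV'.ge hα₀.1).2.antisymm (hge.ge hα.1).2)
    have hrat : ∀ V ∈ T, ogf V ∈ rationalSubring := by
      intro V hV
      obtain ⟨α, hα, rfl⟩ := (mem_T V).1 hV
      exact hU.ogf_mem ((fiber_subset hC α).trans hCU) (isPermClass_fiber hC α)
    obtain ⟨α₀, hα₀, hfα₀⟩ := (mem_T V₀).1 hV₀
    have h0 : ogf V₀ ≠ 0 := ogf_ne_zero (hfα₀ ▸ empty_mem_fiber hα₀.1)
    have hsum := ogf_eq_sum hC (hC.empty_mem hα₀.1) hT
    rw [← Finset.add_sum_erase _ _ hV₀, ogf_indecFiber, hge] at hsum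
    refine mem_rationalSubring_of_mul (hrat V₀ hV₀) h0 ?_
    have : ogf V₀ * ogf (C ∩ Indec) = ogf C - 1 + ogf (fiberGt C V₀ ∩ Indec) * ogf V₀
        - ∑ V ∈ T.erase V₀, ogf (indecFiber C V) * ogf V := by
      rw [hsum]
      ring
    rw [this]
    refine sub_mem (add_mem (sub_mem (hU.ogf_mem hCU hC) (one_mem _))
      (mul_mem (hgt V₀ hV₀) (hrat V₀ hV₀))) (sum_mem fun V hV => ?_)
    obtain ⟨hne, hV⟩ := Finset.mem_erase.1 hV
    exact mul_mem (hpiece V hV (huniq V hV hne)) (hrat V hV)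
  · push Not at hex
    rw [← biUnion_indecFiber hT, ogf_biUnion _ _ (pairwiseDisjoint_indecFiber C _)]
    exact sum_mem fun V hV => hpiece V hV (hex V hV)

theorem StronglyRational.sumCompletion {U : Set Permutation} (hU : StronglyRational U) :
    StronglyRational (sumCompletion U) := by
  classical
  have hpwo := partiallyWellOrderedOn_sumCompletion hU.1 hU.partiallyWellOrderedOn
  refine ⟨(sumCompletion_isLeast U).1.1, fun D hDS hD => isRationalSeries_genFun_iff.2 ?_⟩
  revert D
  refine class_induction hpwo fun C hCS hC ih => ?_
  rcases C.eq_empty_or_nonempty with rfl | ⟨π, hπ⟩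
  · rw [ogf_empty]
    exact zero_mem _
  have hfin := finite_fiber hpwo hCS hC (A := C ∩ Indec) Set.inter_subset_left
  -- `C` is inserted so that its term can be isolated even if no indecomposable has fiber `C`; that
  -- term is then zero.
  let T := insert C hfin.toFinset
  have hT : ∀ α ∈ C ∩ Indec, fiber C α ∈ T := fun α hα =>
    Finset.mem_insert_of_mem (hfin.mem_toFinset.2 ⟨α, hα, rfl⟩)
  have hindec : ∀ D ⊆ C, IsPermClass D → ogf (D ∩ Indec) ∈ rationalSubring := by
    intro D hDC hD
    have : D ∩ Indec = (D ∩ U) ∩ Indec := by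
      ext α
      exact ⟨fun h => ⟨⟨h.1, sumCompletion_inter_indec hU.1 ⟨hCS (hDC h.1), h.2⟩⟩, h.2⟩,
        fun h => ⟨h.1.1, h.2⟩⟩
    rw [this]
    exact hU.ogf_inter_indec_mem _ Set.inter_subset_right
      fun α hα σ hσ => ⟨hD α hα.1 σ hσ, hU.1 α hα.2 σ hσ⟩
  have hpiece : ∀ V, ogf (indecFiber C V) ∈ rationalSubring := by
    intro V
    rw [ogf_indecFiber]
    exact sub_mem (hindec _ (fun β h => h.1) (isPermClass_fiberGe hC V))
      (hindec _ (fun β h => h.1) (isPermClass_fiberGt hC V))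
  have hsum := ogf_eq_sum hC (hC.empty_mem hπ) hT
  rw [← Finset.add_sum_erase _ _ (Finset.mem_insert_self C _)] at hsum
  -- Every fiber other than `C` is a proper subclass, covered by induction. The terms with `ogf C`
  -- combine to the factor `1 - ogf (indecFiber C C)`, whose constant coefficient is 1.
  refine mem_rationalSubring_of_mul (s := 1 - ogf (indecFiber C C))
    (sub_mem (one_mem _) (hpiece C)) (fun h => ?_) ?_
  · have := congrArg PowerSeries.constantCoeff h
    rw [map_sub, constantCoeff_ogf fun α h => h.1.2] at this
    simp at this
  · have : (1 - ogf (indecFiber C C)) * ogf C =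
        1 + ∑ V ∈ T.erase C, ogf (indecFiber C V) * ogf V := by
      rw [sub_mul, one_mul, sub_eq_iff_eq_add]
      linear_combination hsum
    rw [this]
    refine add_mem (one_mem _) (sum_mem fun V hV => mul_mem (hpiece V) ?_)
    obtain ⟨hne, hV⟩ := Finset.mem_erase.1 hV
    obtain ⟨α, -, rfl⟩ := hfin.mem_toFinset.1 (Finset.mem_of_mem_insert_of_ne hV hne)
    exact ih _ (ssubset_of_subset_of_ne (fiber_subset hC α) hne) (isPermClass_fiber hC α)

theorem IsPermClass.inter {C D : Set Permutation} (hC : IsPermClass C) (hD : IsPermClass D) :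
    IsPermClass (C ∩ D) :=
  fun π hπ σ hσ => ⟨hC π hπ.1 σ hσ, hD π hπ.2 σ hσ⟩

theorem StronglyRational.union {D E : Set Permutation} (hD : StronglyRational D)
    (hE : StronglyRational E) : StronglyRational (D ∪ E) := by
  refine ⟨fun π hπ σ hσ => hπ.imp (fun h => hD.1 π h σ hσ) fun h => hE.1 π h σ hσ,
    fun F hF hFc => isRationalSeries_genFun_iff.2 ?_⟩
  have h : F = (F ∩ D) ∪ (F ∩ E) := by
    rw [← Set.inter_union_distrib_left, Set.inter_eq_left.2 hF]
  rw [h, ogf_union_add_inter]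
  exact sub_mem (add_mem (hD.ogf_mem Set.inter_subset_right (hFc.inter hD.1))
    (hE.ogf_mem Set.inter_subset_right (hFc.inter hE.1)))
    (hD.ogf_mem (fun _ h => h.1.2) ((hFc.inter hD.1).inter (hFc.inter hE.1)))

theorem StronglyRational.setSum {D E : Set Permutation} (hD : StronglyRational D)
    (hE : StronglyRational E) : StronglyRational (setSum D E) := by
  have hsub : PermPattern.setSum D E ⊆ PermPattern.sumCompletion (D ∪ E) := by
    obtain ⟨-, hclosed, hU⟩ := (sumCompletion_isLeast (D ∪ E)).1
    rintro _ ⟨α, hα, β, hβ, rfl⟩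
    exact hclosed ⟨α, hU (Or.inl hα), β, hU (Or.inr hβ), rfl⟩
  exact ⟨isPermClass_setSum hD.1 hE.1,
    fun F hF hFc => (hD.union hE).sumCompletion.2 F (hF.trans hsub) hFc⟩

end PermPattern

theorem corollary3p7 :
    (∀ U : Set PermPattern.Permutation, PermPattern.StronglyRational U →
      PermPattern.StronglyRational (PermPattern.sumCompletion U)) ∧
    (∀ D E : Set PermPattern.Permutation,
      PermPattern.StronglyRational D → PermPattern.StronglyRational E →
        PermPattern.StronglyRational (PermPattern.setSum D E)) :=
  ⟨fun _ hU => hU.sumCompletion, fun _ _ hD hE => hD.setSum hE⟩
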